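/- For an ideal $J$ of a commutative noetherian ring $R$ and a finitely generated $R$-module $M$ with $JM\neq M$, let $\operatorname{depth}_J M$ denote the supremum of the lengths of $M$-regular sequences contained in $J$ (and put $\operatorname{depth}_J M=\infty$ if $JM=M$). A nonzero commutative noetherian ring $R$ is called almost Cohen–Macaulay if $\operatorname{depth}_P R=\operatorname{depth}_{PR_P}R_P$ for every $P\in\operatorname{Spec}(R)$. Let $A$ be a commutative noetherian local ring, let $I\neq A$ be an ideal of $A$ contained in the Jacobson radical of $A$, and let $\hat A=\varprojlim_n A/I^n$ be the completion of $A$ in the $I$-adic topology. Then $A$ is almost Cohen–Macaulay if and only if $\hat A$ is almost Cohen–Macaulay. -/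

import Mathlib

/-- The depth `depth_I M` (grade) of an `R`-module `M` with respect to an ideal `I`: the supremum
of the lengths of the `M`-regular sequences consisting of elements of `I`, with the usual
convention that it is infinite when `I M = M`. -/
noncomputable def idealDepth {R : Type*} [CommRing R] (I : Ideal R)
    (M : Type*) [AddCommGroup M] [Module R M] : ℕ∞ :=
  open scoped Classical in
  if I • (⊤ : Submodule R M) = ⊤ then ⊤
  else ⨆ (rs : List R) (_ : ∀ r ∈ rs, r ∈ I) (_ : RingTheory.Sequence.IsRegular M rs),
    (rs.length : ℕ∞)

/-- A commutative ring `R` is almost Cohen-Macaulay if it is a nonzero noetherian ring such that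
`depth_P R = depth_{P R_P} R_P` for every prime ideal `P` of `R`. -/
structure IsAlmostCohenMacaulayRing (R : Type*) [CommRing R] : Prop where
  isNoetherianRing : IsNoetherianRing R
  nontrivial : Nontrivial R
  depth_eq : ∀ (P : Ideal R) [P.IsPrime],
    idealDepth P R =
      idealDepth (IsLocalRing.maximalIdeal (Localization.AtPrime P)) (Localization.AtPrime P)

universe u

open RingTheory.Sequence IsLocalRing
open scoped Pointwise

/-! For a noetherian local ring, being almost Cohen–Macaulay means that the dimension exceeds the
depth by at most one; both directions of this criterion work with a regular sequence `rs` that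
cannot be extended. If the depths agree, every prime containing `rs` is associated to `R ⧸ (rs)`, so
there are finitely many. Prime avoidance then gives one more element making the maximal ideal
minimal over `(rs, z)`, and Krull's height theorem applies (`finite_zeroLocus_of_idealDepth_eq`,
`height_maximalIdeal_le_of_finite_zeroLocus`). Conversely, unequal depths at `P` produce a chain too
long for the dimension bound (`idealDepth_eq_of_height_maximalIdeal_le`). Regular sequences,
non-extendability and finiteness of the zero locus all pass along a flat local map under which the
maximal ideal extends to the maximal ideal. The `I`-adic completion is such a map. -/

/-- The ideal `I` annihilates a nonzero element of `R ⧸ J`. -/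
def Ideal.AnnihilatesNonzero {R : Type*} [CommRing R] (I J : Ideal R) : Prop :=
  ∃ u, u ∉ J ∧ ∀ r ∈ I, r * u ∈ J

/-! ### Regular sequences and depth -/

section Depth

open CategoryTheory Abelian Limits

variable {R : Type u} [CommRing R]

lemma Ideal.AnnihilatesNonzero.not_isSMulRegular {I J : Ideal R} (h : I.AnnihilatesNonzero J)
    {r : R} (hr : r ∈ I) : ¬ IsSMulRegular (R ⧸ J) r := by
  obtain ⟨u, hu, hI⟩ := h
  intro hreg
  refine hu (Ideal.Quotient.eq_zero_iff_mem.mp (hreg ?_))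
  simpa [Algebra.smul_def, ← map_mul, Ideal.Quotient.eq_zero_iff_mem] using hI r hr

lemma Ideal.AnnihilatesNonzero.mono {I I' J : Ideal R} (h : I.AnnihilatesNonzero J)
    (hI : I' ≤ I) : I'.AnnihilatesNonzero J := by
  obtain ⟨u, hu, hu'⟩ := h
  exact ⟨u, hu, fun r hr ↦ hu' r (hI hr)⟩

/-- A nonzero map `R ⧸ I → R ⧸ J` sends `1` to a nonzero class killed by `I`; without such maps, `I`
contains a regular element. -/
lemma Ideal.exists_isSMulRegular_of_not_annihilatesNonzero [IsNoetherianRing R] {I J : Ideal R}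
    (h : ¬ I.AnnihilatesNonzero J) : ∃ r ∈ I, IsSMulRegular (R ⧸ J) r := by
  have key : Subsingleton ((R ⧸ I) →ₗ[R] (R ⧸ J)) := by
    refine subsingleton_of_forall_eq 0 fun f ↦ ?_
    by_contra hf
    obtain ⟨u, hu⟩ := Ideal.Quotient.mk_surjective (f 1)
    refine h ⟨u, fun huJ ↦ hf ?_, fun r hr ↦ ?_⟩
    · have h1 : f 1 = 0 := by rw [← hu, Ideal.Quotient.eq_zero_iff_mem.mpr huJ]
      ext
      simpa using h1
    · rw [← Ideal.Quotient.eq_zero_iff_mem, map_mul, hu]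
      have h2 : (Ideal.Quotient.mk J r) * f 1 = f (r • 1) := by
        rw [map_smul, Algebra.smul_def]; rfl
      rw [h2, Algebra.smul_def, mul_one]
      have : algebraMap R (R ⧸ I) r = 0 := Ideal.Quotient.eq_zero_iff_mem.mpr hr
      rw [this, map_zero]
  simpa [Ideal.annihilator_quotient] using IsSMulRegular.subsingleton_linearMap_iff.mp key

lemma Ideal.smul_top_quotient_ne_top {M : Type*} [AddCommGroup M] [Module R M] {I : Ideal R}
    {N : Submodule R M} (hN : N ≤ I • ⊤) (hI : I • (⊤ : Submodule R M) ≠ ⊤) :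
    I • (⊤ : Submodule R (M ⧸ N)) ≠ ⊤ := by
  intro eq
  apply hI
  have := congrArg (Submodule.comap N.mkQ) eq
  rw [Submodule.comap_smul_top_of_surjective I _ (Submodule.mkQ_surjective _),
    Submodule.ker_mkQ, Submodule.comap_top, sup_eq_left.mpr hN] at this
  exact this

/-- The given sequence need not start with `r`. Depth is therefore read off from vanishing of Ext,
and the long exact sequence of multiplication by `r` costs one degree. -/
lemma exists_isRegular_quotSMulTop [IsNoetherianRing R] {I : Ideal R} {M : Type u}
    [AddCommGroup M] [Module R M] [Module.Finite R M] (hI : I • (⊤ : Submodule R M) ≠ ⊤)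
    {r : R} (hr : r ∈ I) (hreg : IsSMulRegular M r) {ss : List R} (hss : ∀ s ∈ ss, s ∈ I)
    (hssreg : IsRegular M ss) {k : ℕ} (hk : ss.length = k + 1) :
    ∃ ts : List R, ts.length = k ∧ (∀ t ∈ ts, t ∈ I) ∧ IsRegular (QuotSMulTop r M) ts := by
  have hiff := (ModuleCat.exists_isRegular_tfae I (k + 1) (ModuleCat.of R M)
    hI.lt_top).out 1 3
  have hext := hiff.mpr ⟨ss, hk, hss, hssreg⟩
  have hI' : I • (⊤ : Submodule R (QuotSMulTop r M)) ≠ ⊤ := by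
    refine Ideal.smul_top_quotient_ne_top ?_ hI
    rw [← Submodule.ideal_span_singleton_smul]
    exact Submodule.smul_mono_left ((Ideal.span_singleton_le_iff_mem I).mpr hr)
  have hiff' := (ModuleCat.exists_isRegular_tfae I k (ModuleCat.of R (QuotSMulTop r M))
    hI'.lt_top).out 1 3
  refine hiff'.mp fun i hi ↦ ?_
  have zero1 := AddCommGrpCat.isZero_of_iff_subsingleton.mpr (hext i (by omega))
  have zero2 := AddCommGrpCat.isZero_of_iff_subsingleton.mpr (hext (i + 1) (by omega))
  exact AddCommGrpCat.subsingleton_of_isZero <| ShortComplex.Exact.isZero_of_both_zeros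
    ((Ext.covariant_sequence_exact₃' _
      (IsSMulRegular.smulShortComplex_shortExact (M := ModuleCat.of R M) hreg)) i (i + 1) rfl)
    (zero1.eq_zero_of_src _) (zero2.eq_zero_of_tgt _)

/-- Passing to the quotient by a regular sequence of length `n` in `I` lowers the maximal length
of regular sequences in `I` by at most `n`. -/
lemma exists_isRegular_quotient_ofList [IsNoetherianRing R] {I : Ideal R} {M : Type u}
    [AddCommGroup M] [Module R M] [Module.Finite R M] (hI : I • (⊤ : Submodule R M) ≠ ⊤)
    {rs : List R} (hrs : ∀ r ∈ rs, r ∈ I) (hrsreg : IsWeaklyRegular M rs) {ss : List R}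
    (hss : ∀ s ∈ ss, s ∈ I) (hssreg : IsRegular M ss) {k : ℕ}
    (hk : ss.length = rs.length + k) :
    ∃ ts : List R, ts.length = k ∧ (∀ t ∈ ts, t ∈ I) ∧
      IsRegular (M ⧸ (Ideal.ofList rs • ⊤ : Submodule R M)) ts := by
  induction rs generalizing M ss with
  | nil =>
    refine ⟨ss, by simpa using hk, hss, ?_⟩
    have e : (M ⧸ (Ideal.ofList ([] : List R) • ⊤ : Submodule R M)) ≃ₗ[R] M :=
      Submodule.quotEquivOfEqBot _ (by rw [Ideal.ofList_nil]; exact Submodule.bot_smul _)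
    exact (e.isRegular_congr ss).mpr hssreg
  | cons r rs ih =>
    rw [isWeaklyRegular_cons_iff] at hrsreg
    simp only [List.mem_cons, forall_eq_or_imp] at hrs
    obtain ⟨ts, htslen, hts, htsreg⟩ := exists_isRegular_quotSMulTop hI hrs.1 hrsreg.1 hss hssreg
      (k := rs.length + k) (by simp [hk]; omega)
    have hI' : I • (⊤ : Submodule R (QuotSMulTop r M)) ≠ ⊤ := by
      refine Ideal.smul_top_quotient_ne_top ?_ hI
      rw [← Submodule.ideal_span_singleton_smul]
      exact Submodule.smul_mono_left ((Ideal.span_singleton_le_iff_mem I).mpr hrs.1)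
    obtain ⟨us, h1, h2, h3⟩ := ih hI' hrs.2 hrsreg.2 hts htsreg htslen
    exact ⟨us, h1, h2, ((Submodule.quotOfListConsSMulTopEquivQuotSMulTopInner M r rs
      ).isRegular_congr us).mpr h3⟩

lemma RingTheory.Sequence.IsWeaklyRegular.isRegular_of_mem {I : Ideal R} (hI : I ≠ ⊤) {rs : List R}
    (h : IsWeaklyRegular R rs) (hrs : ∀ r ∈ rs, r ∈ I) : IsRegular R rs := by
  refine ⟨h, fun htop ↦ hI (top_le_iff.mp ?_)⟩
  rw [htop, smul_eq_mul, Ideal.mul_top]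
  exact Ideal.span_le.mpr hrs

/-- The quotient by `J • ⊤` agrees with the quotient by the ideal `J`. -/
def Ideal.quotientSMulTopEquiv (J : Ideal R) :
    (R ⧸ (J • ⊤ : Submodule R R)) ≃ₗ[R] R ⧸ J :=
  Submodule.quotEquivOfEq _ _ (by simp)

lemma RingTheory.Sequence.IsWeaklyRegular.append_singleton {rs : List R} (h : IsWeaklyRegular R rs) {r : R}
    (hr : IsSMulRegular (R ⧸ Ideal.ofList rs) r) : IsWeaklyRegular R (rs ++ [r]) := by
  refine (isWeaklyRegular_append_iff R rs [r]).mpr ⟨h, ?_⟩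
  exact (isWeaklyRegular_singleton_iff _ r).mpr
    (((Ideal.ofList rs).quotientSMulTopEquiv.isSMulRegular_congr r).mpr hr)

/-- A regular sequence in `I` which cannot be extended has the maximal possible length. -/
lemma length_le_of_annihilatesNonzero [IsNoetherianRing R] {I : Ideal R} (hI : I ≠ ⊤)
    {rs : List R} (hrs : ∀ r ∈ rs, r ∈ I) (hrsreg : IsWeaklyRegular R rs)
    (h : I.AnnihilatesNonzero (Ideal.ofList rs)) {ss : List R} (hss : ∀ s ∈ ss, s ∈ I)
    (hssreg : IsRegular R ss) : ss.length ≤ rs.length := by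
  by_contra! hlt
  obtain ⟨k, hk⟩ := Nat.exists_eq_add_of_lt hlt
  obtain ⟨ts, htslen, hts, htsreg⟩ := exists_isRegular_quotient_ofList (M := R) (k := k + 1)
    (by simpa using hI) hrs hrsreg hss hssreg (by omega)
  match ts, htslen with
  | t :: ts, _ =>
    refine h.not_isSMulRegular (hts t (by simp)) ?_
    exact ((Ideal.ofList rs).quotientSMulTopEquiv.isSMulRegular_congr t).mp
      ((isRegular_cons_iff _ t ts).mp htsreg).1

lemma le_idealDepth {I : Ideal R} {rs : List R} (hrs : ∀ r ∈ rs, r ∈ I)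
    (hrsreg : IsRegular R rs) : (rs.length : ℕ∞) ≤ idealDepth I R := by
  unfold idealDepth
  split_ifs
  · exact le_top
  · exact le_iSup₂_of_le rs hrs (le_iSup_of_le hrsreg le_rfl)

lemma idealDepth_eq_length [IsNoetherianRing R] {I : Ideal R} (hI : I ≠ ⊤)
    {rs : List R} (hrs : ∀ r ∈ rs, r ∈ I) (hrsreg : IsWeaklyRegular R rs)
    (h : I.AnnihilatesNonzero (Ideal.ofList rs)) : idealDepth I R = rs.length := by
  refine le_antisymm ?_ (le_idealDepth hrs (IsWeaklyRegular.isRegular_of_mem hI hrsreg hrs))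
  unfold idealDepth
  rw [if_neg (by simpa using hI)]
  exact iSup₂_le fun ss hss ↦ iSup_le fun hssreg ↦ by
    exact_mod_cast length_le_of_annihilatesNonzero hI hrs hrsreg h hss hssreg

lemma annihilatesNonzero_of_idealDepth_le [IsNoetherianRing R] {I : Ideal R} (hI : I ≠ ⊤)
    {rs : List R} (hrs : ∀ r ∈ rs, r ∈ I) (hrsreg : IsWeaklyRegular R rs)
    (h : idealDepth I R ≤ rs.length) : I.AnnihilatesNonzero (Ideal.ofList rs) := by
  by_contra hn
  obtain ⟨r, hr, hreg⟩ := Ideal.exists_isSMulRegular_of_not_annihilatesNonzero hn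
  have hmem : ∀ s ∈ rs ++ [r], s ∈ I := by
    simp only [List.mem_append, List.mem_singleton]
    rintro s (hs | rfl)
    exacts [hrs s hs, hr]
  have := (le_idealDepth hmem (IsWeaklyRegular.isRegular_of_mem hI
    (hrsreg.append_singleton hreg) hmem)).trans h
  rw [Nat.cast_le, List.length_append, List.length_singleton] at this
  omega

/-- After localizing at `P`, each term of the sequence lowers the dimension by exactly one. -/
lemma RingTheory.Sequence.IsWeaklyRegular.length_le_height [IsNoetherianRing R] {P : Ideal R} [P.IsPrime] {rs : List R}
    (hrs : ∀ r ∈ rs, r ∈ P) (hrsreg : IsWeaklyRegular R rs) : (rs.length : ℕ∞) ≤ P.height := by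
  have hreg := hrsreg.isRegular_of_isLocalization_of_mem (Localization.AtPrime P) P hrs
  have hdim := Module.supportDim_add_length_eq_supportDim_of_isRegular _ hreg
  have hnt : Nontrivial (Localization.AtPrime P ⧸
      (Ideal.ofList (rs.map (algebraMap R (Localization.AtPrime P))) • ⊤ :
        Submodule (Localization.AtPrime P) (Localization.AtPrime P))) :=
    Submodule.Quotient.nontrivial_iff.mpr hreg.top_ne_smul.symm
  have h0 := Module.supportDim_ne_bot_of_nontrivial (Localization.AtPrime P) (Localization.AtPrime P ⧸
      (Ideal.ofList (rs.map (algebraMap R (Localization.AtPrime P))) • ⊤ :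
        Submodule (Localization.AtPrime P) (Localization.AtPrime P)))
  rw [Module.supportDim_self_eq_ringKrullDim,
    IsLocalization.AtPrime.ringKrullDim_eq_height P (Localization.AtPrime P), List.length_map]
    at hdim
  obtain ⟨d, hd⟩ := WithBot.ne_bot_iff_exists.mp h0
  rw [← hd] at hdim
  have h1 : d + (rs.length : ℕ∞) = P.height := by exact_mod_cast hdim
  exact h1 ▸ le_add_self

/-- Every prime of a noetherian ring contains a regular sequence which cannot be extended. -/
lemma exists_isWeaklyRegular_annihilatesNonzero [IsNoetherianRing R] (P : Ideal R) [P.IsPrime] :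
    ∃ rs : List R, (∀ r ∈ rs, r ∈ P) ∧ IsWeaklyRegular R rs ∧
      P.AnnihilatesNonzero (Ideal.ofList rs) := by
  by_contra! hn
  -- If every sequence could be extended, some length would exceed the finite height of `P`.
  have key : ∀ n : ℕ, ∃ rs : List R, rs.length = n ∧ (∀ r ∈ rs, r ∈ P) ∧
      IsWeaklyRegular R rs := by
    intro n
    induction n with
    | zero => exact ⟨[], by simp⟩
    | succ n ih =>
      obtain ⟨rs, hlen, hmem, hreg⟩ := ih
      obtain ⟨r, hr, hrreg⟩ :=
        Ideal.exists_isSMulRegular_of_not_annihilatesNonzero (hn rs hmem hreg)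
      refine ⟨rs ++ [r], by simp [hlen], ?_, hreg.append_singleton hrreg⟩
      simp only [List.mem_append, List.mem_singleton]
      rintro s (hs | rfl)
      exacts [hmem s hs, hr]
  obtain ⟨n, hn'⟩ := ENat.ne_top_iff_exists.mp (Ideal.height_ne_top (I := P) (Ideal.IsPrime.ne_top ‹_›))
  obtain ⟨rs, hlen, hmem, hreg⟩ := key (n + 1)
  have := hreg.length_le_height hmem
  rw [← hn', hlen] at this
  norm_cast at this
  omega

end Depth

/-! ### Associated primes -/

section Associated

variable {R : Type u} [CommRing R]

lemma mem_associatedPrimes_quotient_iff [IsNoetherianRing R] {J Q : Ideal R} :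
    Q ∈ associatedPrimes R (R ⧸ J) ↔ Q.IsPrime ∧ ∃ u, ∀ r, r ∈ Q ↔ r * u ∈ J := by
  have key (r u : R) : r ∈ (⊥ : Submodule R (R ⧸ J)).colon {Ideal.Quotient.mk J u} ↔
      r * u ∈ J := by
    rw [Submodule.mem_colon_singleton, Submodule.mem_bot, Algebra.smul_def,
      Ideal.Quotient.algebraMap_eq, ← map_mul, Ideal.Quotient.eq_zero_iff_mem]
  rw [AssociatedPrimes.mem_iff, isAssociatedPrime_iff]
  refine and_congr_right fun _ ↦ ⟨?_, ?_⟩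
  · rintro ⟨x, hx⟩
    obtain ⟨u, rfl⟩ := Ideal.Quotient.mk_surjective x
    exact ⟨u, fun r ↦ by rw [← key, hx]⟩
  · rintro ⟨u, hu⟩
    exact ⟨Ideal.Quotient.mk J u, Ideal.ext fun r ↦ by rw [hu, key]⟩

lemma Ideal.AnnihilatesNonzero.exists_le_associatedPrimes [IsNoetherianRing R] {I J : Ideal R}
    (h : I.AnnihilatesNonzero J) : ∃ Q ∈ associatedPrimes R (R ⧸ J), I ≤ Q := by
  obtain ⟨u, hu, hI⟩ := h
  obtain ⟨Q, hQ, hle⟩ := exists_le_isAssociatedPrime_of_isNoetherianRing R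
    (Ideal.Quotient.mk J u) (by rwa [Ne, Ideal.Quotient.eq_zero_iff_mem])
  refine ⟨Q, hQ, fun r hr ↦ hle ?_⟩
  rw [Submodule.mem_colon_singleton, Submodule.mem_bot, Algebra.smul_def,
    Ideal.Quotient.algebraMap_eq, ← map_mul, Ideal.Quotient.eq_zero_iff_mem]
  exact hI r hr

lemma annihilatesNonzero_map_localization_iff [IsNoetherianRing R] {J P : Ideal R} [P.IsPrime] :
    (maximalIdeal (Localization.AtPrime P)).AnnihilatesNonzero
      (J.map (algebraMap R (Localization.AtPrime P))) ↔ P ∈ associatedPrimes R (R ⧸ J) := by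
  have hmem (x : R) : algebraMap R (Localization.AtPrime P) x ∈
      J.map (algebraMap R (Localization.AtPrime P)) ↔ ∃ s, s ∉ P ∧ s * x ∈ J := by
    rw [IsLocalization.algebraMap_mem_map_algebraMap_iff P.primeCompl]
    exact ⟨fun ⟨s, hs, h⟩ ↦ ⟨s, hs, h⟩, fun ⟨s, hs, h⟩ ↦ ⟨s, hs, h⟩⟩
  rw [mem_associatedPrimes_quotient_iff]
  constructor
  · rintro ⟨v, hv, hmax⟩
    refine ⟨inferInstance, ?_⟩
    obtain ⟨⟨u, s⟩, hus⟩ := IsLocalization.surj P.primeCompl v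
    have hu : algebraMap R (Localization.AtPrime P) u ∉
        J.map (algebraMap R (Localization.AtPrime P)) := by
      rw [← hus, mul_comm, Ideal.unit_mul_mem_iff_mem _ (IsLocalization.map_units _ s)]
      exact hv
    have hPu (r : R) (hr : r ∈ P) : ∃ t, t ∉ P ∧ t * (r * u) ∈ J := by
      rw [← hmem, map_mul, ← hus, ← mul_assoc]
      refine Ideal.mul_mem_right _ _ (hmax _ ?_)
      exact (IsLocalization.AtPrime.to_map_mem_maximal_iff _ P r).mpr hr
    obtain ⟨T, hT⟩ := (isNoetherianRing_iff_ideal_fg R).mp ‹_› P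
    choose! t htP ht using hPu
    have hTP (r : R) (hr : r ∈ T) : r ∈ P := hT ▸ Ideal.subset_span hr
    -- A single denominator serves all of `P`, since `P` is finitely generated; `P` is then exactly
    -- the annihilator of the class of this product times `u`.
    have hprod : ∏ r ∈ T, t r ∉ P := by
      rw [Ideal.IsPrime.prod_mem_iff]
      rintro ⟨r, hr, hrP⟩
      exact htP r (hTP r hr) hrP
    refine ⟨(∏ r ∈ T, t r) * u, fun r ↦ ⟨fun hr ↦ ?_, fun hr ↦ ?_⟩⟩
    · rw [← hT] at hr
      have hle : Ideal.span (T : Set R) ≤ J.colon {(∏ r ∈ T, t r) * u} := by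
        refine Ideal.span_le.mpr fun a ha ↦ ?_
        rw [SetLike.mem_coe, Submodule.mem_colon_singleton, smul_eq_mul]
        obtain ⟨w, hw⟩ := Finset.dvd_prod_of_mem t ha
        rw [hw, show a * (t a * w * u) = w * (t a * (a * u)) by ring]
        exact J.mul_mem_left _ (ht a (hTP a ha))
      simpa [Submodule.mem_colon_singleton] using hle hr
    · by_contra hrP
      refine hu ((hmem u).mpr ⟨r * ∏ r ∈ T, t r, fun h ↦ ?_, by rwa [mul_assoc]⟩)
      exact (Ideal.IsPrime.mem_or_mem ‹_› h).elim hrP hprod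
  · rintro ⟨_, u, hu⟩
    refine ⟨algebraMap R _ u, ?_, ?_⟩
    · rw [hmem]
      rintro ⟨s, hs, hsu⟩
      exact hs ((hu s).mpr hsu)
    · intro r hr
      obtain ⟨⟨a, s⟩, has⟩ := IsLocalization.surj P.primeCompl r
      rw [← Ideal.unit_mul_mem_iff_mem _ (IsLocalization.map_units _ s), ← mul_assoc,
        mul_comm (algebraMap R _ _) r, has, ← map_mul]
      refine Ideal.mem_map_of_mem _ ((hu a).mp ?_)
      rw [← IsLocalization.AtPrime.to_map_mem_maximal_iff (Localization.AtPrime P) P, ← has]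
      exact Ideal.mul_mem_right _ _ hr

variable [IsLocalRing R]

/-- The depth of a finite module is bounded by the dimension of `R ⧸ Q` for every associated
prime `Q`. -/
lemma RingTheory.Sequence.IsWeaklyRegular.length_le_coheight [IsNoetherianRing R] {M : Type*}
    [AddCommGroup M] [Module R M] [Module.Finite R M] {ts : List R}
    (hts : ∀ t ∈ ts, t ∈ maximalIdeal R) (hreg : IsWeaklyRegular M ts) (Q : PrimeSpectrum R)
    (hQ : Q.asIdeal ∈ associatedPrimes R M) : (ts.length : ℕ∞) ≤ Order.coheight Q := by
  induction ts generalizing M Q with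
  | nil => simp
  | cons t ts ih =>
    rw [isWeaklyRegular_cons_iff] at hreg
    simp only [List.mem_cons, forall_eq_or_imp] at hts
    obtain ⟨_, x, hx⟩ := isAssociatedPrime_iff.mp hQ
    have hmem (r : R) : r ∈ Q.asIdeal ↔ r • x = 0 := by
      rw [hx, Submodule.mem_colon_singleton, Submodule.mem_bot]
    have hx0 : x ≠ 0 := by
      rintro rfl
      exact Q.2.ne_top ((Ideal.eq_top_iff_one _).mpr ((hmem 1).mpr (smul_zero _)))
    let N : Submodule R M := Submodule.torsionBySet R M Q.asIdeal
    have hNmem (v : M) : v ∈ N ↔ ∀ r ∈ Q.asIdeal, r • v = 0 := by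
      rw [Submodule.mem_torsionBySet_iff]
      exact ⟨fun h r hr ↦ h ⟨r, hr⟩, fun h r ↦ h r r.2⟩
    -- Nakayama: as `t` is regular, `N ≤ tM` would force `N = tN`, hence `N = 0`, although `x ∈ N`.
    have hN : ¬ N ≤ t • (⊤ : Submodule R M) := by
      intro hle
      have hbot : N = ⊥ := by
        refine Submodule.eq_bot_of_le_smul_of_le_jacobson_bot (Ideal.span {t}) N
          (IsNoetherian.noetherian N) (fun v hv ↦ ?_) ?_
        · obtain ⟨w, -, rfl⟩ := Submodule.mem_smul_pointwise_iff_exists _ _ _ |>.mp (hle hv)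
          refine Submodule.smul_mem_smul (Ideal.mem_span_singleton_self t)
            ((hNmem w).mpr fun r hr ↦ hreg.1 ?_)
          simpa [smul_comm t r w] using (hNmem _).mp hv r hr
        · rw [IsLocalRing.jacobson_eq_maximalIdeal ⊥ bot_ne_top]
          exact (Ideal.span_singleton_le_iff_mem _).mpr hts.1
      exact hx0 ((Submodule.mem_bot R).mp (hbot ▸ (hNmem x).mpr fun r hr ↦ (hmem r).mp hr))
    obtain ⟨v, hvN, hv⟩ := SetLike.not_le_iff_exists.mp hN
    obtain ⟨Q', hQ', hle⟩ := exists_le_isAssociatedPrime_of_isNoetherianRing R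
      (Submodule.Quotient.mk v : QuotSMulTop t M)
      (by rwa [Ne, Submodule.Quotient.mk_eq_zero])
    have hcol {r : R} (hr : r • v ∈ t • (⊤ : Submodule R M)) : r ∈ Q' := by
      refine hle ?_
      rwa [Submodule.mem_colon_singleton, Submodule.mem_bot, ← Submodule.Quotient.mk_smul,
        Submodule.Quotient.mk_eq_zero]
    -- `Q` kills `v`, and `t` lies in `Q'` but not in `Q`, being regular on `M`.
    have hlt : Q < ⟨Q', hQ'.isPrime⟩ := by
      refine lt_of_le_of_ne ?_ ?_
      · intro r hr
        exact hcol (by rw [(hNmem v).mp hvN r hr]; exact zero_mem _)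
      · rintro rfl
        refine hx0 (hreg.1 ?_)
        have : t ∈ Q' := hcol (Submodule.smul_mem_pointwise_smul v t ⊤ trivial)
        simpa using (hmem t).mp this
    refine le_trans ?_ (Order.coheight_add_one_le hlt)
    rw [List.length_cons, Nat.cast_succ]
    gcongr
    exact ih hts.2 hreg.2 _ hQ'

end Associated

/-! ### Dimension at most depth plus one -/

section Criterion

variable {R : Type u} [CommRing R] [IsNoetherianRing R]

/-- The sequence is already maximal in each such `P`, so equality of depths makes it maximal in
`R_P` too. Hence `P` is associated to `R ⧸ (rs)`. -/
lemma finite_zeroLocus_of_idealDepth_eq {m : Ideal R}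
    (h : ∀ (P : Ideal R) [P.IsPrime], idealDepth P R =
      idealDepth (maximalIdeal (Localization.AtPrime P)) (Localization.AtPrime P))
    {rs : List R} (hreg : IsWeaklyRegular R rs) (hm : m.AnnihilatesNonzero (Ideal.ofList rs)) :
    {P : Ideal R | P.IsPrime ∧ Ideal.ofList rs ≤ P ∧ P ≤ m}.Finite := by
  refine (associatedPrimes.finite R (R ⧸ Ideal.ofList rs)).subset ?_
  rintro P ⟨_, hrsP, hPm⟩
  have hmem (r : R) (hr : r ∈ rs) : r ∈ P := hrsP (Ideal.subset_span hr)
  have hloc := hreg.isRegular_of_isLocalization_of_mem (Localization.AtPrime P) P hmem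
  rw [← annihilatesNonzero_map_localization_iff, Ideal.map_ofList]
  refine annihilatesNonzero_of_idealDepth_le (Ideal.IsPrime.ne_top inferInstance) ?_
    hloc.toIsWeaklyRegular ?_
  · intro r hr
    obtain ⟨a, ha, rfl⟩ := List.mem_map.mp hr
    exact (IsLocalization.AtPrime.to_map_mem_maximal_iff _ P a).mpr (hmem a ha)
  · rw [← h P, List.length_map,
      idealDepth_eq_length (Ideal.IsPrime.ne_top inferInstance) hmem hreg (hm.mono hPm)]

variable [IsLocalRing R]

lemma height_maximalIdeal_le_of_finite_zeroLocus {rs : List R}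
    (hrs : ∀ r ∈ rs, r ∈ maximalIdeal R)
    (h : {P : Ideal R | P.IsPrime ∧ Ideal.ofList rs ≤ P}.Finite) :
    (maximalIdeal R).height ≤ rs.length + 1 := by
  classical
  obtain ⟨z, hz, hzP⟩ : ∃ z ∈ maximalIdeal R, ∀ P : Ideal R, P.IsPrime → Ideal.ofList rs ≤ P →
      P ≠ maximalIdeal R → z ∉ P := by
    by_contra! hn
    have hfin : {P : Ideal R | (P.IsPrime ∧ Ideal.ofList rs ≤ P) ∧ P ≠ maximalIdeal R}.Finite :=
      h.subset fun P hP ↦ hP.1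
    obtain ⟨P, hP, hle⟩ := (Ideal.subset_union_prime_finite hfin (f := id) ⊥ ⊥
      (fun P hP _ _ ↦ hP.1.1) (I := maximalIdeal R)).mp fun z hz ↦ by
        obtain ⟨P, h1, h2, h3, h4⟩ := hn z hz
        exact Set.mem_biUnion (show P ∈ {P : Ideal R | _} from ⟨⟨h1, h2⟩, h3⟩) h4
    exact hP.2 (le_antisymm (le_maximalIdeal hP.1.1.ne_top) hle)
  have hspan : maximalIdeal R ∈
      (Ideal.span ((insert z rs.toFinset : Finset R) : Set R)).minimalPrimes := by
    refine ⟨⟨inferInstance, Ideal.span_le.mpr ?_⟩, fun P ⟨hP, hle⟩ _ ↦ ?_⟩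
    · intro r hr
      simp only [Finset.coe_insert, List.coe_toFinset, Set.mem_insert_iff, Set.mem_ofPred_eq] at hr
      rcases hr with rfl | hr
      exacts [hz, hrs r hr]
    · have hsub := Ideal.span_le.mp hle
      have hzin : z ∈ P := hsub (by simp)
      by_contra hne
      refine hzP P hP (Ideal.span_le.mpr fun r hr ↦ hsub ?_) (fun h ↦ hne h.ge) hzin
      simp only [Finset.coe_insert, List.coe_toFinset, Set.mem_insert_iff, Set.mem_ofPred_eq]
      exact Or.inr hr
  refine (Ideal.height_le_card_of_mem_minimalPrimes_span_finset hspan).trans ?_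
  exact_mod_cast (Finset.card_insert_le _ _).trans
    (Nat.add_le_add_right (List.toFinset_card_le rs) 1)

/-- Let `ys` be a maximal regular sequence in `P`. If the depths differ, `P` is not associated to `R
⧸ (ys)`, so it lies strictly between a minimal prime `P₀` of `(ys)` and an associated prime `Q`.
Then `Q` has height at least `ys.length + 2` and coheight at least `xs.length - ys.length`, which
contradicts the bound. -/
lemma idealDepth_eq_of_height_maximalIdeal_le {xs : List R} (hxs : ∀ x ∈ xs, x ∈ maximalIdeal R)
    (hxsreg : IsWeaklyRegular R xs) (hdim : (maximalIdeal R).height ≤ xs.length + 1)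
    (P : Ideal R) [P.IsPrime] : idealDepth P R =
      idealDepth (maximalIdeal (Localization.AtPrime P)) (Localization.AtPrime P) := by
  obtain ⟨ys, hys, hysreg, hann⟩ := exists_isWeaklyRegular_annihilatesNonzero P
  have hysP : Ideal.ofList ys ≤ P := Ideal.span_le.mpr hys
  have hPm : P ≤ maximalIdeal R := le_maximalIdeal (Ideal.IsPrime.ne_top ‹_›)
  have hysloc := hysreg.isRegular_of_isLocalization_of_mem (Localization.AtPrime P) P hys
  suffices hass : P ∈ associatedPrimes R (R ⧸ Ideal.ofList ys) by
    rw [idealDepth_eq_length (Ideal.IsPrime.ne_top ‹_›) hys hysreg hann,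
      idealDepth_eq_length (Ideal.IsPrime.ne_top inferInstance) ?_ hysloc.toIsWeaklyRegular,
      List.length_map]
    · rwa [← Ideal.map_ofList, annihilatesNonzero_map_localization_iff]
    · intro r hr
      obtain ⟨a, ha, rfl⟩ := List.mem_map.mp hr
      exact (IsLocalization.AtPrime.to_map_mem_maximal_iff _ P a).mpr (hys a ha)
  by_contra hass
  obtain ⟨Q, hQ, hPQ⟩ := hann.exists_le_associatedPrimes
  have hQprime : Q.IsPrime := hQ.isPrime
  have hPQ' : P < Q := lt_of_le_of_ne hPQ fun h ↦ hass (h ▸ hQ)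
  obtain ⟨P₀, hP₀prime, hysP₀, hP₀P⟩ : ∃ P₀ : Ideal R, P₀.IsPrime ∧ Ideal.ofList ys ≤ P₀ ∧
      P₀ < P := by
    obtain ⟨P₀, hP₀, hle⟩ := Ideal.exists_minimalPrimes_le hysP
    refine ⟨P₀, hP₀.1.1, hP₀.1.2, lt_of_le_of_ne hle ?_⟩
    rintro rfl
    refine hass (Module.associatedPrimes.minimalPrimes_annihilator_subset_associatedPrimes R _ ?_)
    rwa [Ideal.annihilator_quotient]
  -- Truncated subtraction is harmless: when `ys` is longer, the height of `Q` alone is large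
  -- enough.
  have hk : ((xs.length - ys.length : ℕ) : ℕ∞) ≤ Order.coheight (⟨Q, hQprime⟩ : PrimeSpectrum R) := by
    rcases le_total ys.length xs.length with hle | hle
    · obtain ⟨ts, htslen, hts, htsreg⟩ := exists_isRegular_quotient_ofList (M := R)
        (I := maximalIdeal R) (by simpa using Ideal.IsPrime.ne_top inferInstance)
        (fun y hy ↦ hPm (hys y hy)) hysreg hxs
        (hxsreg.isRegular_of_mem (Ideal.IsPrime.ne_top inferInstance) hxs)
        (k := xs.length - ys.length) (by omega)
      rw [← htslen]
      exact ((Ideal.quotientSMulTopEquiv _).isWeaklyRegular_congr ts |>.mp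
        htsreg.toIsWeaklyRegular).length_le_coheight hts ⟨Q, hQprime⟩ hQ
    · simp [Nat.sub_eq_zero_of_le hle]
  have hh₀ : (ys.length : ℕ∞) ≤ Order.height (⟨P₀, hP₀prime⟩ : PrimeSpectrum R) := by
    have := hysreg.length_le_height (P := P₀) fun y hy ↦ hysP₀ (Ideal.subset_span hy)
    exact this.trans_eq (PrimeSpectrum.height_eq_orderHeight ⟨P₀, hP₀prime⟩)
  have hh : (ys.length : ℕ∞) + 2 ≤ Order.height (⟨Q, hQprime⟩ : PrimeSpectrum R) := by
    have h1 : (⟨P₀, hP₀prime⟩ : PrimeSpectrum R) < ⟨P, inferInstance⟩ := hP₀P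
    have h2 : (⟨P, inferInstance⟩ : PrimeSpectrum R) < ⟨Q, hQprime⟩ := hPQ'
    calc (ys.length : ℕ∞) + 2 = ys.length + 1 + 1 := by rw [add_assoc]; norm_num
      _ ≤ Order.height (⟨P₀, hP₀prime⟩ : PrimeSpectrum R) + 1 + 1 := by gcongr
      _ ≤ Order.height (⟨P, inferInstance⟩ : PrimeSpectrum R) + 1 := by
        gcongr; exact Order.height_add_one_le h1
      _ ≤ _ := Order.height_add_one_le h2
  have hdim' : ringKrullDim R ≤ ((xs.length + 1 : ℕ) : ℕ∞) := by
    rw [← IsLocalRing.maximalIdeal_height_eq_ringKrullDim]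
    exact_mod_cast hdim
  have hsum : ((Order.height (⟨Q, hQprime⟩ : PrimeSpectrum R) +
      Order.coheight (⟨Q, hQprime⟩ : PrimeSpectrum R) : ℕ∞) : WithBot ℕ∞) ≤ ringKrullDim R := by
    rw [ringKrullDim, Order.krullDim_eq_iSup_height_add_coheight_of_nonempty]
    exact_mod_cast le_iSup (fun a : PrimeSpectrum R ↦ Order.height a + Order.coheight a) _
  have hfinal := (WithBot.coe_le_coe.mp (hsum.trans hdim'))
  have := (add_le_add hh hk).trans hfinal
  norm_cast at this
  omega

end Criterion

/-! ### Transfer along flat local homomorphisms -/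

section FaithfullyFlat

variable {A : Type*} {B : Type*} [CommRing A] [CommRing B] [Algebra A B]

lemma Ideal.AnnihilatesNonzero.map_of_faithfullyFlat [Module.FaithfullyFlat A B] {I J : Ideal A}
    (h : I.AnnihilatesNonzero J) :
    (I.map (algebraMap A B)).AnnihilatesNonzero (J.map (algebraMap A B)) := by
  obtain ⟨u, hu, hI⟩ := h
  refine ⟨algebraMap A B u, fun huJ ↦ hu ?_, fun r hr ↦ ?_⟩
  · rwa [← Ideal.mem_comap, Ideal.comap_map_eq_self_of_faithfullyFlat] at huJ
  · have hle : I.map (algebraMap A B) ≤ (J.map (algebraMap A B)).colon {algebraMap A B u} := by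
      refine Ideal.map_le_iff_le_comap.mpr fun a ha ↦ ?_
      rw [Ideal.mem_comap, Submodule.mem_colon_singleton, smul_eq_mul, ← map_mul]
      exact Ideal.mem_map_of_mem _ (hI a ha)
    simpa [Submodule.mem_colon_singleton] using hle hr

variable [IsNoetherianRing A] [IsNoetherianRing B] [IsLocalRing A] [IsLocalRing B]

/-- The image of a system of parameters of `A` still cuts out the maximal ideal of `B`. -/
lemma height_maximalIdeal_le_of_map_eq
    (hmap : (maximalIdeal A).map (algebraMap A B) = maximalIdeal B) :
    (maximalIdeal B).height ≤ (maximalIdeal A).height := by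
  classical
  obtain ⟨s, hs, hcard⟩ := Ideal.exists_finset_card_eq_height_of_isNoetherianRing (maximalIdeal A)
  have hmin : maximalIdeal B ∈
      (Ideal.span ((s.image (algebraMap A B) : Finset B) : Set B)).minimalPrimes := by
    rw [Finset.coe_image, ← Ideal.map_span]
    refine ⟨⟨inferInstance, hmap ▸ Ideal.map_mono hs.1.2⟩, fun P ⟨hP, hle⟩ _ ↦ ?_⟩
    rw [← hmap, Ideal.map_le_iff_le_comap]
    exact hs.2 ⟨inferInstance, Ideal.map_le_iff_le_comap.mp hle⟩
      (le_maximalIdeal (Ideal.IsPrime.ne_top inferInstance))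
  refine (Ideal.height_le_card_of_mem_minimalPrimes_span_finset hmin).trans ?_
  rw [← hcard]
  exact_mod_cast Finset.card_image_le

/-- The almost Cohen-Macaulay property ascends and descends along a flat local homomorphism whose
closed fibre is a field. -/
lemma isAlmostCohenMacaulayRing_iff_of_flat [Module.Flat A B]
    (hmap : (maximalIdeal A).map (algebraMap A B) = maximalIdeal B) :
    IsAlmostCohenMacaulayRing A ↔ IsAlmostCohenMacaulayRing B := by
  have : IsLocalHom (algebraMap A B) :=
    ((IsLocalRing.local_hom_TFAE (algebraMap A B)).out 0 2).mpr hmap.le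
  have : Module.FaithfullyFlat A B := .of_flat_of_isLocalHom
  obtain ⟨rs, hrs, hreg, hann⟩ := exists_isWeaklyRegular_annihilatesNonzero (maximalIdeal A)
  have hrsB : ∀ b ∈ rs.map (algebraMap A B), b ∈ maximalIdeal B := by
    intro b hb
    obtain ⟨a, ha, rfl⟩ := List.mem_map.mp hb
    exact hmap ▸ Ideal.mem_map_of_mem _ (hrs a ha)
  have hregB : IsWeaklyRegular B (rs.map (algebraMap A B)) := hreg.of_flat
  constructor
  · intro h
    refine ⟨inferInstance, inferInstance, fun P _ ↦
      idealDepth_eq_of_height_maximalIdeal_le hrsB hregB ?_ P⟩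
    rw [List.length_map]
    refine (height_maximalIdeal_le_of_map_eq hmap).trans
      (height_maximalIdeal_le_of_finite_zeroLocus hrs ?_)
    refine (finite_zeroLocus_of_idealDepth_eq h.depth_eq hreg hann).subset ?_
    exact fun P ⟨hP, hle⟩ ↦ ⟨hP, hle, le_maximalIdeal hP.ne_top⟩
  · intro h
    refine ⟨inferInstance, inferInstance, fun P _ ↦
      idealDepth_eq_of_height_maximalIdeal_le hrs hreg ?_ P⟩
    refine height_maximalIdeal_le_of_finite_zeroLocus hrs ?_
    have hannB := hann.map_of_faithfullyFlat (B := B)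
    rw [Ideal.map_ofList] at hannB
    -- No comparison of dimensions is needed here: the primes over `rs` are contractions of the
    -- finitely many primes over its image.
    refine ((finite_zeroLocus_of_idealDepth_eq h.depth_eq hregB hannB).image
      (Ideal.comap (algebraMap A B))).subset ?_
    rintro P ⟨hP, hle⟩
    obtain ⟨Q, hQ⟩ := PrimeSpectrum.comap_surjective_of_faithfullyFlat (B := B)
      (⟨P, hP⟩ : PrimeSpectrum A)
    have hQP : Q.asIdeal.comap (algebraMap A B) = P := congrArg PrimeSpectrum.asIdeal hQ
    refine ⟨Q.asIdeal, ⟨Q.2, ?_, ?_⟩, hQP⟩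
    · rwa [← Ideal.map_ofList, Ideal.map_le_iff_le_comap, hQP]
    · exact hmap ▸ le_maximalIdeal Q.2.ne_top

end FaithfullyFlat

/-! ### Adic completions of noetherian rings -/

namespace AdicCompletion

variable {R : Type*} [CommRing R] [IsNoetherianRing R] (I : Ideal R)

lemma exists_sub_algebraMap_mem_map (y : AdicCompletion I R) :
    ∃ r : R, y - algebraMap R (AdicCompletion I R) r ∈
      I.map (algebraMap R (AdicCompletion I R)) := by
  obtain ⟨r, hr⟩ := Ideal.Quotient.mk_surjective (evalOneₐ I y)
  refine ⟨r, ?_⟩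
  rw [← ker_evalOneₐ_eq_map I I.fg_of_isNoetherianRing, RingHom.mem_ker, map_sub, sub_eq_zero]
  exact hr.symm.trans (congrArg (fun f : R →+* R ⧸ I ↦ f r) (evalOneₐ_comp_algebraMap_eq_mk I)).symm

-- The surjection `φ` induces a map of completions that is surjective modulo `J`, hence surjective
-- by completeness of the source and separatedness of the target.
variable {I} in
lemma isNoetherianRing_of_map_eq {S : Type*} [CommRing S] {J : Ideal S} (hJ : J.FG)
    [IsNoetherianRing (AdicCompletion J S)] {φ : S →+* R} (hφ : Function.Surjective φ)
    (hφJ : J.map φ = I) : IsNoetherianRing (AdicCompletion I R) := by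
  have hle (n : ℕ) : J ^ n ≤ (I ^ n).comap φ := by
    rw [← Ideal.map_le_iff_le_comap, Ideal.map_pow, hφJ]
  let f (n : ℕ) : AdicCompletion J S →+* R ⧸ I ^ n :=
    (Ideal.quotientMap (I ^ n) φ (hle n)).comp (evalₐ J n).toRingHom
  have hf {m n : ℕ} (hmn : m ≤ n) : (Ideal.Quotient.factorPow I hmn).comp (f n) = f m := by
    refine RingHom.ext fun x ↦ ?_
    obtain ⟨x, rfl⟩ := mk_surjective J S x
    simp only [f, AlgHom.toRingHom_eq_coe, RingHom.comp_apply, RingHom.coe_coe, evalₐ_mk,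
      Ideal.quotientMap_mk]
    refine (Ideal.Quotient.mk_eq_mk_iff_sub_mem _ _).mpr ?_
    rw [← map_sub]
    refine hle m ((Ideal.Quotient.mk_eq_mk_iff_sub_mem _ _).mp ?_)
    exact (Ideal.mk_eq_mk J hmn x)
  let g : AdicCompletion J S →+* AdicCompletion I R := liftRingHom I f hf
  have hg : g.comp (algebraMap S (AdicCompletion J S)) =
      (algebraMap R (AdicCompletion I R)).comp φ := by
    refine RingHom.ext fun x ↦ ext_evalₐ fun n ↦ ?_
    refine (evalₐ_liftRingHom I f hf n _).trans ?_
    simp only [f, RingHom.comp_apply, AlgHom.toRingHom_eq_coe, RingHom.coe_coe, AlgHom.commutes]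
    exact Ideal.quotientMap_mk
  have hgJ : (J.map (algebraMap S (AdicCompletion J S))).map g =
      I.map (algebraMap R (AdicCompletion I R)) := by
    rw [Ideal.map_map, hg, ← Ideal.map_map, hφJ]
  have := isAdicComplete_self J hJ
  have := isAdicComplete_self I I.fg_of_isNoetherianRing
  have : IsHausdorff ((J.map (algebraMap S (AdicCompletion J S))).map g) (AdicCompletion I R) := by
    rw [hgJ]; infer_instance
  refine isNoetherianRing_of_surjective _ _ g (surjective_of_mk_map_comp_surjective
    (I := J.map (algebraMap S (AdicCompletion J S))) g fun y ↦ ?_)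
  obtain ⟨y, rfl⟩ := Ideal.Quotient.mk_surjective y
  obtain ⟨r, hr⟩ := exists_sub_algebraMap_mem_map I y
  obtain ⟨x, rfl⟩ := hφ r
  refine ⟨algebraMap S _ x, ?_⟩
  rw [RingHom.comp_apply, ← RingHom.comp_apply g, hg, eq_comm,
    Ideal.Quotient.mk_eq_mk_iff_sub_mem, hgJ]
  exact hr

/-- The adic completion of a noetherian ring is noetherian, as a quotient of a power series
ring. -/
lemma isNoetherianRing_of_isNoetherianRing : IsNoetherianRing (AdicCompletion I R) := by
  obtain ⟨s, hs⟩ := (isNoetherianRing_iff_ideal_fg R).mp ‹_› I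
  have : IsNoetherianRing
      (AdicCompletion (MvPolynomial.idealOfVars s R) (MvPolynomial s R)) :=
    isNoetherianRing_of_ringEquiv _ (MvPowerSeries.toAdicCompletionAlgEquiv s R).toRingEquiv
  refine isNoetherianRing_of_map_eq (MvPolynomial.idealOfVars_fg s R)
    (φ := MvPolynomial.eval fun x : s ↦ (x : R)) (fun r ↦ ⟨MvPolynomial.C r, by simp⟩) ?_
  rw [MvPolynomial.idealOfVars, Ideal.map_span, ← Set.range_comp, ← hs]
  congr 1
  ext x
  simp

variable [IsLocalRing R] {I}

lemma isLocalRing_and_maximalIdeal_eq (hI : I ≠ ⊤) :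
    ∃ _ : IsLocalRing (AdicCompletion I R), (maximalIdeal R).map
      (algebraMap R (AdicCompletion I R)) = maximalIdeal (AdicCompletion I R) := by
  have hmax := isMaximal_map_of_le I (maximalIdeal R) (le_maximalIdeal hI) I.fg_of_isNoetherianRing
  have := isAdicComplete_self I I.fg_of_isNoetherianRing
  have hloc : IsLocalRing (AdicCompletion I R) := by
    refine .of_unique_max_ideal ⟨_, hmax, fun N hN ↦ hN.eq_of_le hmax.ne_top fun y hy ↦ ?_⟩
    obtain ⟨r, hr⟩ := exists_sub_algebraMap_mem_map I y
    have hrN : algebraMap R (AdicCompletion I R) r ∈ N := by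
      -- By completeness the extension of `I` lies in every maximal ideal `N`, so membership in `N`
      -- is decided by the approximation `r`.
      have := ((IsAdicComplete.le_jacobson_bot _).trans (sInf_le ⟨bot_le, hN⟩)) hr
      simpa using N.sub_mem hy this
    have hrm : r ∈ maximalIdeal R := fun hu ↦
      hN.ne_top (Ideal.eq_top_of_isUnit_mem _ hrN (hu.map _))
    rw [← sub_add_cancel y (algebraMap R (AdicCompletion I R) r)]
    exact add_mem (Ideal.map_mono (le_maximalIdeal hI) hr) (Ideal.mem_map_of_mem _ hrm)
  exact ⟨hloc, IsLocalRing.eq_maximalIdeal hmax⟩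

end AdicCompletion

theorem corollary2p3 {A : Type*} [CommRing A] [IsNoetherianRing A] [IsLocalRing A]
    (I : Ideal A) (hI : I ≠ ⊤) (hIJ : I ≤ Ideal.jacobson (⊥ : Ideal A)) :
    IsAlmostCohenMacaulayRing A ↔ IsAlmostCohenMacaulayRing (AdicCompletion I A) := by
  have := AdicCompletion.isNoetherianRing_of_isNoetherianRing I
  obtain ⟨_, hmap⟩ := AdicCompletion.isLocalRing_and_maximalIdeal_eq hI
  exact isAlmostCohenMacaulayRing_iff_of_flat hmap
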